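/- Let $(W,S)$ be a finite Coxeter system of rank $m=|S|$, that is, $W$ is a finite group with a presentation $W=\langle S\mid (st)^{M(s,t)}=1\rangle$, where $M(s,s)=1$ and $M(s,t)=M(t,s)\ge 2$ for $s\neq t$. For $J\subseteq S$ let $\langle J\rangle\le W$ be the (standard) subgroup generated by $J$. For an integer $r\in\{-1,0,\dots,m\}$ let the order-$r$ Coxeter code $C_W(r)$ be the $\mathbb F_2$-linear span, in the space of functions $W\to\mathbb F_2$, of the indicator functions of the left cosets $\sigma\langle J\rangle$ with $\sigma\in W$, $J\subseteq S$ and $|J|=m-r$. If $\lfloor m/2\rfloor\le r\le m$, then the minimum Hamming distance of $C_W(r)$ is exactly $2^{m-r}$. Moreover, it is attained by the indicator function of a standard subgroup generated by commuting generators: there is a set $J\subseteq S$ of $m-r$ pairwise commuting generators such that the indicator function of $\langle J\rangle$ belongs to $C_W(r)$ and has Hamming weight $2^{m-r}$. -/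

import Mathlib

open scoped Pointwise

namespace CoxeterCode

/-- The indicator function of a subset of `W`, as a binary vector with coordinates in `W`. -/
noncomputable def indicator {W : Type*} (U : Set W) : W → ZMod 2 :=
  U.indicator 1

/-- The minimum Hamming distance between distinct codewords of a binary linear code
(`0` if there are no two distinct codewords). -/
noncomputable def minDist {W : Type*} [Fintype W] (C : Submodule (ZMod 2) (W → ZMod 2)) : ℕ :=
  sInf {d : ℕ | ∃ x ∈ C, ∃ y ∈ C, x ≠ y ∧ hammingDist x y = d}

variable {B W : Type*} [Group W] {M : CoxeterMatrix B}

/-- The standard subgroup generated by the simple generators indexed by `J`. -/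
def standardSubgroup (cs : CoxeterSystem M W) (J : Finset B) : Subgroup W :=
  Subgroup.closure (cs.simple '' (J : Set B))

/-- The order-`r` Coxeter code of a Coxeter system of rank `m`: the binary span of the indicator
functions of the standard left cosets `σ⟨J⟩` of rank `|J| = m - r`. -/
noncomputable def code [Fintype B] (cs : CoxeterSystem M W) (r : ℤ) :
    Submodule (ZMod 2) (W → ZMod 2) :=
  Submodule.span (ZMod 2)
    {f | ∃ (σ : W) (J : Finset B), (J.card : ℤ) = (Fintype.card B : ℤ) - r ∧
      f = indicator (σ • (standardSubgroup cs J : Set W))}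

end CoxeterCode

/-! Lower bound: standard subgroups of ranks `m - r` and `r + 1` share a generator, so every
codeword has even weight on each coset of rank `r + 1`. Induction on the generating set turns this
into weight at least `2 ^ (m - r)` (`two_pow_le_card_of_even`); the induction needs `⟨J⟩ ∩ ⟨K⟩ ⊆ ⟨J
∩ K⟩` (`mem_standardSubgroup_inter`). Upper bound: finiteness of `W` gives a positive definite
invariant form, which forces a vertex of degree at most one in each nonempty induced Coxeter graph.
Greedy choice then finds at least `m / 2` commuting generators (`exists_commuting_subset`), and `m -
r` of them generate a subgroup of order at most `2 ^ (m - r)`. -/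

namespace CoxeterCode

variable {B W : Type*} [Group W] {M : CoxeterMatrix B}

/-! ### Inversion parity and descents in standard subgroups -/

open scoped Classical in
/-- The permutation `(t, ε) ↦ (sᵢ t sᵢ, ε + [t = sᵢ])` of `W × ZMod 2`. -/
noncomputable def reflectionPerm (cs : CoxeterSystem M W) (i : B) : Equiv.Perm (W × ZMod 2) :=
  Function.Involutive.toPerm
    (fun p => (cs.simple i * p.1 * cs.simple i, p.2 + if p.1 = cs.simple i then 1 else 0)) <| by
    rintro ⟨t, ε⟩
    have h : cs.simple i * t * cs.simple i = cs.simple i ↔ t = cs.simple i := by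
      constructor
      · intro h
        have := congrArg (fun x => cs.simple i * x) h
        simp only [mul_assoc, cs.simple_mul_simple_cancel_left, cs.simple_mul_simple_self] at this
        rw [mul_eq_one_iff_eq_inv, cs.inv_simple] at this
        exact this
      · rintro rfl
        simp
    ext
    · simp [mul_assoc]
    · simp only [h, add_assoc]
      split_ifs
      · rw [show (1 : ZMod 2) + 1 = 0 from rfl, add_zero]
      · simp

open scoped Classical in
theorem reflectionPerm_apply (cs : CoxeterSystem M W) (i : B) (t : W) (ε : ZMod 2) :
    reflectionPerm cs i (t, ε) =
      (cs.simple i * t * cs.simple i, ε + if t = cs.simple i then 1 else 0) := rfl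

theorem simple_mul_mul_pow (cs : CoxeterSystem M W) (i j : B) (l : ℕ) :
    cs.simple j * (cs.simple i * cs.simple j) ^ l =
      ((cs.simple i * cs.simple j) ^ l)⁻¹ * cs.simple j := by
  induction l with
  | zero => simp
  | succ l ih =>
    rw [pow_succ, ← mul_assoc, ih, ← pow_succ, pow_succ', mul_inv_rev, mul_inv_rev, cs.inv_simple,
      cs.inv_simple]
    simp only [mul_assoc]

open scoped Classical in
theorem reflectionPerm_mul_pow_apply (cs : CoxeterSystem M W) (i j : B) (k : ℕ) (t : W)
    (ε : ZMod 2) :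
    ((reflectionPerm cs i * reflectionPerm cs j) ^ k) (t, ε) =
      ((cs.simple i * cs.simple j) ^ k * t * ((cs.simple i * cs.simple j) ^ k)⁻¹,
        ε + ∑ l ∈ Finset.range (2 * k),
          if t = cs.simple j * (cs.simple i * cs.simple j) ^ l then 1 else 0) := by
  induction k with
  | zero => simp
  | succ k ih =>
    rw [pow_succ', Equiv.Perm.mul_apply, ih, Equiv.Perm.mul_apply, reflectionPerm_apply,
      reflectionPerm_apply, show 2 * (k + 1) = 2 * k + 1 + 1 by ring, Finset.sum_range_succ,
      Finset.sum_range_succ]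
    set a := cs.simple i * cs.simple j with ha
    have h1 : a ^ k * t * (a ^ k)⁻¹ = cs.simple j ↔ t = cs.simple j * a ^ (2 * k) := by
      rw [two_mul, pow_add, ← mul_assoc, simple_mul_mul_pow, mul_inv_eq_iff_eq_mul, mul_assoc,
        ← eq_inv_mul_iff_mul_eq]
    have h2 : cs.simple j * (a ^ k * t * (a ^ k)⁻¹) * cs.simple j = cs.simple i ↔
        t = cs.simple j * a ^ (2 * k + 1) := by
      have e : cs.simple j * a ^ (2 * k + 1) =
          (a ^ k)⁻¹ * (cs.simple j * (cs.simple i * cs.simple j)) * a ^ k := by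
        rw [show 2 * k + 1 = k + (1 + k) by ring, pow_add, ← mul_assoc, simple_mul_mul_pow,
          pow_add, pow_one, ← ha]
        simp only [mul_assoc]
      rw [e]
      constructor
      · intro h
        rw [← h]
        simp [mul_assoc]
      · intro h
        rw [h]
        simp [mul_assoc]
    ext
    · simp [ha, pow_succ', mul_assoc]
    · simp only [h1, h2, add_assoc]

/-- For `k = M i j` the sum over `2 * k` terms consists of two equal halves, because `(sᵢ sⱼ) ^ k =
1`, and so vanishes mod 2. -/
theorem isLiftable_reflectionPerm (cs : CoxeterSystem M W) :
    M.IsLiftable (reflectionPerm cs) := by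
  classical
  intro i j
  ext1 ⟨t, ε⟩
  rw [reflectionPerm_mul_pow_apply, cs.simple_mul_simple_pow, two_mul, Finset.sum_range_add]
  simp only [pow_add, cs.simple_mul_simple_pow, one_mul, CharTwo.add_self_eq_zero]
  simp

/-- The action of `W` on `W × ZMod 2` extending `reflectionPerm`. -/
noncomputable def reflectionAction (cs : CoxeterSystem M W) : W →* Equiv.Perm (W × ZMod 2) :=
  cs.lift ⟨reflectionPerm cs, isLiftable_reflectionPerm cs⟩

theorem reflectionAction_simple (cs : CoxeterSystem M W) (i : B) :
    reflectionAction cs (cs.simple i) = reflectionPerm cs i :=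
  cs.lift_apply_simple _ i

open scoped Classical in
theorem reflectionAction_wordProd (cs : CoxeterSystem M W) (ω : List B) (t : W) (ε : ZMod 2) :
    reflectionAction cs (cs.wordProd ω) (t, ε) =
      (cs.wordProd ω * t * (cs.wordProd ω)⁻¹, ε + ((cs.rightInvSeq ω).count t : ZMod 2)) := by
  induction ω with
  | nil => simp
  | cons i ω ih =>
    rw [cs.wordProd_cons, map_mul, Equiv.Perm.mul_apply, ih, reflectionAction_simple,
      reflectionPerm_apply, CoxeterSystem.rightInvSeq, List.count_cons]
    have h : cs.wordProd ω * t * (cs.wordProd ω)⁻¹ = cs.simple i ↔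
        (cs.wordProd ω)⁻¹ * cs.simple i * cs.wordProd ω = t := by
      constructor
      · intro h
        rw [← h]
        simp [mul_assoc]
      · rintro rfl
        simp [mul_assoc]
    ext
    · simp [mul_assoc]
    · simp [h, add_assoc]

/-- A generator flips the sign bit only at itself, and conjugation by `⟨J⟩` preserves the complement
of `⟨J⟩`. -/
theorem reflectionAction_of_mem_standardSubgroup (cs : CoxeterSystem M W) (J : Finset B) {w : W}
    (hw : w ∈ standardSubgroup cs J) :
    ∀ t ∉ standardSubgroup cs J, ∀ ε, reflectionAction cs w (t, ε) = (w * t * w⁻¹, ε) := by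
  have conj {w t : W} (hw : w ∈ standardSubgroup cs J) (ht : t ∉ standardSubgroup cs J) :
      w * t * w⁻¹ ∉ standardSubgroup cs J := by
    rwa [Subgroup.mul_mem_cancel_right _ (inv_mem hw), Subgroup.mul_mem_cancel_left _ hw]
  induction hw using Subgroup.closure_induction with
  | mem x hx =>
    intro t ht ε
    have hx' : x ∈ standardSubgroup cs J := Subgroup.subset_closure hx
    obtain ⟨i, -, rfl⟩ := hx
    rw [reflectionAction_simple, reflectionPerm_apply, if_neg, cs.inv_simple, add_zero]
    rintro rfl
    exact ht hx'
  | one => simp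
  | mul x y hx hy ihx ihy =>
    intro t ht ε
    rw [map_mul, Equiv.Perm.mul_apply, ihy t ht, ihx _ (conj hy ht)]
    simp [mul_assoc]
  | inv x hx ih =>
    intro t ht ε
    have := ih _ (conj (inv_mem hx) ht) ε
    rw [map_inv, Equiv.Perm.inv_eq_iff_eq, this]
    simp [mul_assoc]

/-- A reduced word for `w` ending in `i` has `sᵢ` exactly once in its inversion sequence, so `w`
flips the bit at `sᵢ`; elements of `⟨J⟩` flip no bit outside `⟨J⟩`. -/
theorem simple_mem_standardSubgroup_of_isRightDescent (cs : CoxeterSystem M W) (J : Finset B)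
    {w : W} (hw : w ∈ standardSubgroup cs J) {i : B} (hi : cs.IsRightDescent w i) :
    cs.simple i ∈ standardSubgroup cs J := by
  classical
  by_contra h
  obtain ⟨ω, hω, hwω⟩ := cs.exists_isReduced (w * cs.simple i)
  have hw' : cs.wordProd (ω.concat i) = w := by
    rw [cs.wordProd_concat, ← hwω, cs.simple_mul_simple_cancel_right]
  have hred : cs.IsReduced (ω.concat i) := by
    rw [CoxeterSystem.IsReduced, hw', List.length_concat, ← hω.eq, ← hwω]
    exact ((cs.isRightDescent_iff).1 hi).symm
  have hmem : cs.simple i ∈ cs.rightInvSeq (ω.concat i) := by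
    rw [cs.rightInvSeq_concat]
    simp
  have hcount := List.count_eq_one_of_mem hred.nodup_rightInvSeq hmem
  have key := reflectionAction_wordProd cs (ω.concat i) (cs.simple i) 0
  rw [hw', hcount, reflectionAction_of_mem_standardSubgroup cs J hw _ h] at key
  simpa using congrArg Prod.snd key

/-! ### The geometric representation -/

open Module Polynomial.Chebyshev in
-- The power is a combination with Chebyshev coefficients `S_k(2 cos θ) = sin ((k + 1) θ) / sin θ`,
-- `θ = 2π / n`. A factor of each correction term vanishes: `S_{k-1}` if `n = 2k`, `S_k + S_{k-1}`
-- if `n = 2k + 1`.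
theorem reflection_mul_reflection_pow_eq_one {V : Type*} [AddCommGroup V] [Module ℝ V]
    {x y : V} {f g : Dual ℝ V} (hf : f x = 2) (hg : g y = 2) {n : ℕ} (hn : 3 ≤ n)
    (hfg : f y * g x = 4 * Real.cos (Real.pi / n) ^ 2) :
    (reflection hf * reflection hg) ^ n = 1 := by
  have hn' : (3 : ℝ) ≤ n := by exact_mod_cast hn
  have hpos : (0 : ℝ) < n := by linarith
  have ht : 2 * Real.cos (2 * (Real.pi / n)) = f y * g x - 2 := by
    rw [hfg, Real.cos_two_mul]; ring
  have hsin : Real.sin (2 * (Real.pi / n)) ≠ 0 := by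
    refine (Real.sin_pos_of_pos_of_lt_pi (by positivity) ?_).ne'
    rw [← mul_div_assoc, div_lt_iff₀ hpos]
    nlinarith [Real.pi_pos]
  have hS (k : ℤ) : (S ℝ k).eval (2 * Real.cos (2 * (Real.pi / n))) =
      Real.sin ((k + 1) * (2 * (Real.pi / n))) / Real.sin (2 * (Real.pi / n)) := by
    rw [eq_div_iff hsin, S_two_mul_real_cos]
  ext z
  rw [reflection_mul_reflection_pow_apply hf hg n z _ ht]
  obtain ⟨k, hk | hk⟩ := n.even_or_odd'
  · have h0 : (S ℝ ((k : ℤ) - 1)).eval (2 * Real.cos (2 * (Real.pi / n))) = 0 := by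
      rw [hS, show (((k : ℤ) - 1 : ℤ) + 1 : ℝ) * (2 * (Real.pi / n)) = Real.pi by
        rw [hk] at hpos ⊢
        push_cast at hpos ⊢
        have : (k : ℝ) ≠ 0 := by linarith
        field_simp
        ring]
      simp
    rw [show ((n : ℤ) - 2) / 2 = k - 1 by omega, show ((n : ℤ) - 1) / 2 = k - 1 by omega, h0]
    simp
  · have h0 : (S ℝ (k : ℤ)).eval (2 * Real.cos (2 * (Real.pi / n))) +
        (S ℝ ((k : ℤ) - 1)).eval (2 * Real.cos (2 * (Real.pi / n))) = 0 := by
      have e : (((k : ℤ) : ℝ) + 1) * (2 * (Real.pi / n)) =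
          2 * Real.pi - (((k : ℤ) - 1 : ℤ) + 1 : ℝ) * (2 * (Real.pi / n)) := by
        rw [hk] at hpos ⊢
        push_cast at hpos ⊢
        field_simp
        ring
      rw [hS, hS, e, Real.sin_two_pi_sub]
      ring
    rw [show ((n : ℤ) - 2) / 2 = k - 1 by omega, show ((n : ℤ) - 1) / 2 = k by omega,
      show ((n : ℤ) - 3) / 2 = k - 1 by omega, show (n : ℤ) / 2 = k by omega, h0]
    simp

section Geometric

variable [Fintype B]

/-- The linear form `v ↦ 2 ⟨αᵢ, v⟩` of the geometric representation. -/
noncomputable def corootForm (M : CoxeterMatrix B) (i : B) : Module.Dual ℝ (B → ℝ) :=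
  ∑ j, (-2 * Real.cos (Real.pi / M i j)) • LinearMap.proj j

variable [DecidableEq B]

theorem corootForm_single (M : CoxeterMatrix B) (i j : B) :
    corootForm M i (Pi.single j 1) = -2 * Real.cos (Real.pi / M i j) := by
  simp [corootForm, Pi.single_apply]

theorem corootForm_single_self (M : CoxeterMatrix B) (i : B) :
    corootForm M i (Pi.single i 1) = 2 := by
  simp [corootForm_single]

/-- The reflection of the geometric representation attached to a simple generator. -/
noncomputable def simpleReflection (M : CoxeterMatrix B) (i : B) : (B → ℝ) ≃ₗ[ℝ] (B → ℝ) :=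
  Module.reflection (corootForm_single_self M i)

theorem simpleReflection_apply (M : CoxeterMatrix B) (i : B) (v : B → ℝ) :
    simpleReflection M i v = v - corootForm M i v • Pi.single i 1 :=
  Module.reflection_apply _ _

theorem isLiftable_simpleReflection (M : CoxeterMatrix B) : M.IsLiftable (simpleReflection M) := by
  intro i j
  have hsq (i : B) : simpleReflection M i * simpleReflection M i = 1 := by
    ext1 v
    exact Module.involutive_reflection _ v
  obtain rfl | hij := eq_or_ne i j
  · rw [hsq, one_pow]
  obtain h0 | h2 | h3 : M i j = 0 ∨ M i j = 2 ∨ 3 ≤ M i j := by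
    have := M.off_diagonal i j hij
    omega
  · rw [h0, pow_zero]
  · have hcomm : simpleReflection M i * simpleReflection M j =
        simpleReflection M j * simpleReflection M i := by
      have e1 : corootForm M i (Pi.single j 1) = 0 := by simp [corootForm_single, h2]
      have e2 : corootForm M j (Pi.single i 1) = 0 := by
        simp [corootForm_single, M.symmetric j i, h2]
      ext1 v
      simp only [LinearEquiv.mul_apply, simpleReflection_apply, map_sub, map_smul, e1, e2]
      module
    rw [h2, pow_two, mul_assoc, ← mul_assoc (simpleReflection M j), ← hcomm, mul_assoc, hsq,
      mul_one, hsq]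
  · refine reflection_mul_reflection_pow_eq_one _ _ h3 ?_
    rw [corootForm_single, corootForm_single, M.symmetric j i]
    ring

/-- The geometric representation of a Coxeter group. -/
noncomputable def geometricRep (cs : CoxeterSystem M W) : W →* ((B → ℝ) ≃ₗ[ℝ] (B → ℝ)) :=
  cs.lift ⟨simpleReflection M, isLiftable_simpleReflection M⟩

theorem geometricRep_simple (cs : CoxeterSystem M W) (i : B) :
    geometricRep cs (cs.simple i) = simpleReflection M i :=
  cs.lift_apply_simple _ i

theorem geometricRep_apply_of_notMem (cs : CoxeterSystem M W) {J : Finset B} {w : W}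
    (hw : w ∈ standardSubgroup cs J) {i : B} (hi : i ∉ J) (v : B → ℝ) :
    geometricRep cs w v i = v i := by
  induction hw using Subgroup.closure_induction generalizing v with
  | mem x hx =>
    obtain ⟨j, hj, rfl⟩ := hx
    have : i ≠ j := by rintro rfl; exact hi hj
    simp [geometricRep_simple, simpleReflection_apply, this]
  | one => simp
  | mul x y _ _ ihx ihy => rw [map_mul, LinearEquiv.mul_apply, ihx, ihy]
  | inv x _ ih =>
    rw [← ih (geometricRep cs x⁻¹ v), ← LinearEquiv.mul_apply, ← map_mul, mul_inv_cancel, map_one,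
      LinearEquiv.coe_one, id]

end Geometric

/-- `⟨J⟩` fixes every coordinate outside `J`, while `sᵢ` negates the `i`-th simple root. -/
theorem simple_mem_standardSubgroup_iff [Finite B] (cs : CoxeterSystem M W) {J : Finset B} {i : B} :
    cs.simple i ∈ standardSubgroup cs J ↔ i ∈ J := by
  classical
  have := Fintype.ofFinite B
  refine ⟨fun h => ?_, fun h => Subgroup.subset_closure ⟨i, h, rfl⟩⟩
  by_contra hi
  have := geometricRep_apply_of_notMem cs h hi (Pi.single i 1)
  rw [geometricRep_simple, simpleReflection_apply, corootForm_single_self] at this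
  norm_num at this

/-! ### Intersections of standard subgroups -/

theorem standardSubgroup_mono (cs : CoxeterSystem M W) {J K : Finset B} (h : J ⊆ K) :
    standardSubgroup cs J ≤ standardSubgroup cs K :=
  Subgroup.closure_mono (Set.image_mono (by exact_mod_cast h))

/-- A right descent of `w` belongs to both `J` and `K`; strip it and induct on length. -/
theorem mem_standardSubgroup_inter [Finite B] [DecidableEq B] (cs : CoxeterSystem M W)
    {J K : Finset B} {w : W} (hJ : w ∈ standardSubgroup cs J) (hK : w ∈ standardSubgroup cs K) :
    w ∈ standardSubgroup cs (J ∩ K) := by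
  induction hn : cs.length w using Nat.strong_induction_on generalizing w with
  | _ n ih =>
    obtain rfl | hw := eq_or_ne w 1
    · exact one_mem _
    obtain ⟨i, hi⟩ := cs.exists_rightDescent_of_ne_one hw
    have hiJ := simple_mem_standardSubgroup_of_isRightDescent cs J hJ hi
    have hiK := simple_mem_standardSubgroup_of_isRightDescent cs K hK hi
    have hiJK : cs.simple i ∈ standardSubgroup cs (J ∩ K) := by
      rw [simple_mem_standardSubgroup_iff] at *
      exact Finset.mem_inter.2 ⟨hiJ, hiK⟩
    rw [← cs.simple_mul_simple_cancel_right (w := w) i]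
    exact mul_mem (ih _ (hn ▸ hi) (mul_mem hJ hiJ) (mul_mem hK hiK) rfl) hiJK

/-! ### The invariant form and the Coxeter graph -/

section InvariantForm

variable [Fintype B] [DecidableEq B] [Fintype W]

/-- The average over `W` of the standard scalar product in the geometric representation. -/
noncomputable def invariantForm (cs : CoxeterSystem M W) : LinearMap.BilinForm ℝ (B → ℝ) :=
  ∑ w, (dotProductBilin ℝ ℝ).compl₁₂ (geometricRep cs w).toLinearMap
    (geometricRep cs w).toLinearMap

theorem invariantForm_apply (cs : CoxeterSystem M W) (u v : B → ℝ) :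
    invariantForm cs u v = ∑ w, geometricRep cs w u ⬝ᵥ geometricRep cs w v := by
  simp [invariantForm, LinearMap.sum_apply]

theorem invariantForm_comm (cs : CoxeterSystem M W) (u v : B → ℝ) :
    invariantForm cs u v = invariantForm cs v u := by
  simp only [invariantForm_apply, dotProduct_comm]

theorem invariantForm_geometricRep (cs : CoxeterSystem M W) (w : W) (u v : B → ℝ) :
    invariantForm cs (geometricRep cs w u) (geometricRep cs w v) = invariantForm cs u v := by
  simp only [invariantForm_apply, ← LinearEquiv.mul_apply, ← map_mul]
  exact Fintype.sum_equiv (Equiv.mulRight w) _ _ fun _ => rfl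

theorem invariantForm_pos (cs : CoxeterSystem M W) {v : B → ℝ} (hv : v ≠ 0) :
    0 < invariantForm cs v v := by
  rw [invariantForm_apply]
  refine Finset.sum_pos (fun w _ => ?_) Finset.univ_nonempty
  refine lt_of_le_of_ne (Finset.sum_nonneg fun i _ => mul_self_nonneg _) fun h => hv ?_
  exact (LinearEquiv.map_eq_zero_iff _).1 (dotProduct_self_eq_zero.1 h.symm)

theorem invariantForm_single (cs : CoxeterSystem M W) (i j : B) :
    invariantForm cs (Pi.single i 1) (Pi.single j 1) =
      -Real.cos (Real.pi / M i j) * invariantForm cs (Pi.single i 1) (Pi.single i 1) := by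
  have h := invariantForm_geometricRep cs (cs.simple i) (Pi.single i 1) (Pi.single j 1)
  rw [geometricRep_simple, simpleReflection_apply, simpleReflection_apply, corootForm_single_self,
    corootForm_single] at h
  simp only [map_sub, map_smul, LinearMap.sub_apply, LinearMap.smul_apply, smul_eq_mul] at h
  linarith

theorem cos_pi_div_nonneg (n : ℕ) (hn : n ≠ 1) : 0 ≤ Real.cos (Real.pi / n) := by
  -- The label `0` stands for infinity: `π / 0 = 0` has cosine 1, the correct limit.
  obtain rfl | h : n = 0 ∨ 2 ≤ n := by omega
  · simp
  · have h' : (2 : ℝ) ≤ n := by exact_mod_cast h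
    refine Real.cos_nonneg_of_neg_pi_div_two_le_of_le ?_ ?_
    · have := Real.pi_pos
      have : 0 ≤ Real.pi / n := by positivity
      linarith
    · exact div_le_div_of_nonneg_left Real.pi_pos.le two_pos h'

theorem half_le_cos_pi_div (n : ℕ) (h1 : n ≠ 1) (h2 : n ≠ 2) :
    1 / 2 ≤ Real.cos (Real.pi / n) := by
  obtain rfl | h : n = 0 ∨ 3 ≤ n := by omega
  · norm_num
  · have h' : (3 : ℝ) ≤ n := by exact_mod_cast h
    rw [← Real.cos_pi_div_three]
    have := Real.pi_pos
    exact Real.cos_le_cos_of_nonneg_of_le_pi (by positivity) (by linarith)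
      (div_le_div_of_nonneg_left Real.pi_pos.le three_pos h')

/-- Gram matrix of the normalized simple roots. -/
theorem exists_pos_invariantForm_smul_single (cs : CoxeterSystem M W) :
    ∃ a : B → ℝ, (∀ i, 0 < a i) ∧ ∀ i j,
      invariantForm cs (a i • Pi.single i 1) (a j • Pi.single j 1) =
        -Real.cos (Real.pi / M i j) := by
  have hpos (i : B) : 0 < invariantForm cs (Pi.single i 1) (Pi.single i 1) :=
    invariantForm_pos cs (by simp)
  refine ⟨fun i => (Real.sqrt (invariantForm cs (Pi.single i 1) (Pi.single i 1)))⁻¹,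
    fun i => inv_pos.2 (Real.sqrt_pos.2 (hpos i)), fun i j => ?_⟩
  have hij := invariantForm_single cs i j
  have hji := invariantForm_single cs j i
  rw [invariantForm_comm, hij, M.symmetric j i] at hji
  simp only [map_smul, LinearMap.smul_apply, smul_eq_mul]
  rw [hij]
  -- Unless the cosine vanishes, symmetry of the form forces both roots to have the same length.
  by_cases h0 : Real.cos (Real.pi / M i j) = 0
  · simp [h0]
  · have hc := mul_left_cancel₀ (neg_ne_zero.2 h0) hji
    rw [← hc]
    have hs := Real.mul_self_sqrt (hpos i).le
    have hs0 := (Real.sqrt_pos.2 (hpos i)).ne'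
    set c := Real.sqrt (invariantForm cs (Pi.single i 1) (Pi.single i 1))
    rw [← hs]
    field_simp

/-- If all degrees in `T` were at least 2, the sum `v` of the unit roots would have norm at most `∑
(1 - 2 · 1/2) = 0`, although `v ≠ 0`. -/
theorem exists_card_noncommuting_le_one (cs : CoxeterSystem M W) {T : Finset B}
    (hT : T.Nonempty) : ∃ i ∈ T, (T.filter fun j => j ≠ i ∧ M i j ≠ 2).card ≤ 1 := by
  by_contra! hdeg
  obtain ⟨a, ha, hgram⟩ := exists_pos_invariantForm_smul_single cs
  have hv : ∑ i ∈ T, a i • (Pi.single i 1 : B → ℝ) ≠ 0 := by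
    obtain ⟨i, hi⟩ := hT
    intro h
    have := congrFun h i
    simp [Finset.sum_apply, Pi.single_apply, hi, (ha i).ne'] at this
  have hpos := invariantForm_pos cs hv
  simp only [map_sum, LinearMap.sum_apply, hgram] at hpos
  refine hpos.not_ge (Finset.sum_nonpos fun i hi => ?_)
  have hle : ∀ j ∈ T.erase i, -Real.cos (Real.pi / M j i) ≤
      if j ≠ i ∧ M i j ≠ 2 then -(1 / 2) else 0 := by
    intro j hj
    have h1 := M.off_diagonal j i (Finset.ne_of_mem_erase hj)
    split_ifs with h
    · exact neg_le_neg (half_le_cos_pi_div _ h1 (M.symmetric i j ▸ h.2))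
    · exact neg_nonpos.2 (cos_pi_div_nonneg _ h1)
  have hcard : (2 : ℝ) ≤ ((T.filter fun j => j ≠ i ∧ M i j ≠ 2).card : ℝ) := by
    exact_mod_cast hdeg i hi
  have hfilter : (T.erase i).filter (fun j => j ≠ i ∧ M i j ≠ 2) =
      T.filter fun j => j ≠ i ∧ M i j ≠ 2 := by
    ext j
    simp only [Finset.mem_filter, Finset.mem_erase]
    tauto
  have hsum := Finset.sum_le_sum hle
  rw [← Finset.sum_filter, Finset.sum_const, nsmul_eq_mul, hfilter] at hsum
  rw [← Finset.add_sum_erase _ _ hi, M.diagonal, Nat.cast_one, div_one, Real.cos_pi]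
  linarith

end InvariantForm

/-! ### Commuting generators -/

/-- Choosing a vertex of degree at most one costs at most two elements of `T`: itself and its
neighbour. -/
theorem exists_commuting_subset [Finite B] [Finite W] (cs : CoxeterSystem M W) (T : Finset B) :
    ∃ J ⊆ T, T.card ≤ 2 * J.card ∧ (J : Set B).Pairwise fun i j => M i j = 2 := by
  classical
  have := Fintype.ofFinite B
  have := Fintype.ofFinite W
  induction T using Finset.strongInduction with
  | _ T ih =>
    obtain rfl | hT := T.eq_empty_or_nonempty
    · exact ⟨∅, by simp⟩
    obtain ⟨i, hi, hdeg⟩ := exists_card_noncommuting_le_one cs hT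
    set N := T.filter fun j => j ≠ i ∧ M i j ≠ 2 with hN
    obtain ⟨J, hJT, hcard, hJ⟩ := ih ((T.erase i) \ N)
      (Finset.ssubset_of_subset_of_ssubset Finset.sdiff_subset (Finset.erase_ssubset hi))
    have hmem : ∀ j ∈ J, j ≠ i ∧ j ∈ T ∧ M i j = 2 := by
      intro j hj
      have := hJT hj
      simp only [hN, Finset.mem_sdiff, Finset.mem_erase, Finset.mem_filter] at this
      tauto
    refine ⟨insert i J, ?_, ?_, ?_⟩
    · rw [Finset.insert_subset_iff]
      exact ⟨hi, fun j hj => (hmem j hj).2.1⟩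
    · rw [Finset.card_insert_of_notMem fun h => (hmem i h).1 rfl]
      have h1 := Finset.le_card_sdiff N (T.erase i)
      have h2 := Finset.card_erase_add_one hi
      omega
    · rw [Finset.coe_insert, Set.pairwise_insert]
      refine ⟨hJ, fun j hj _ => ⟨(hmem j hj).2.2, ?_⟩⟩
      rw [M.symmetric]
      exact (hmem j hj).2.2

theorem commute_simple_of_eq_two (cs : CoxeterSystem M W) {i j : B} (h : M i j = 2) :
    Commute (cs.simple i) (cs.simple j) := by
  have := cs.simple_mul_simple_pow i j
  rw [h, pow_two, mul_eq_one_iff_eq_inv, mul_inv_rev, cs.inv_simple, cs.inv_simple] at this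
  exact this

/-- An upper bound suffices: the lower bound on codeword weights gives the equality. -/
theorem card_standardSubgroup_le [Finite W] (cs : CoxeterSystem M W) (J : Finset B)
    (hJ : (J : Set B).Pairwise fun i j => Commute (cs.simple i) (cs.simple j)) :
    (standardSubgroup cs J : Set W).ncard ≤ 2 ^ J.card := by
  classical
  induction J using Finset.induction_on with
  | empty => simp [standardSubgroup]
  | insert i J hi ih =>
    rw [Finset.coe_insert, Set.pairwise_insert] at hJ
    have hsub : (standardSubgroup cs (insert i J) : Set W) ⊆
        (standardSubgroup cs J : Set W) ∪ (· * cs.simple i) '' (standardSubgroup cs J : Set W) := by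
      intro w hw
      suffices h : w ∈ standardSubgroup cs J ∨ w * cs.simple i ∈ standardSubgroup cs J by
        exact h.imp_right fun h => ⟨_, h, cs.simple_mul_simple_cancel_right i⟩
      have step (x : W) (j : B) (hj : j ∈ insert i J)
          (hx : x ∈ standardSubgroup cs J ∨ x * cs.simple i ∈ standardSubgroup cs J) :
          x * cs.simple j ∈ standardSubgroup cs J ∨
            x * cs.simple j * cs.simple i ∈ standardSubgroup cs J := by
        obtain rfl | hj := Finset.mem_insert.1 hj
        · rw [cs.simple_mul_simple_cancel_right]
          exact hx.symm
        · have hjJ : cs.simple j ∈ standardSubgroup cs J := Subgroup.subset_closure ⟨j, hj, rfl⟩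
          refine hx.imp (fun h => mul_mem h hjJ) fun h => ?_
          rw [mul_assoc, ← (hJ.2 j hj (by rintro rfl; exact hi hj)).1.eq, ← mul_assoc]
          exact mul_mem h hjJ
      induction hw using Subgroup.closure_induction_right with
      | one => exact Or.inl (one_mem _)
      | mul_right x hx y hy ih =>
        obtain ⟨j, hj, rfl⟩ := hy
        exact step x j hj ih
      | mul_inv_cancel x hx y hy ih =>
        obtain ⟨j, hj, rfl⟩ := hy
        rw [cs.inv_simple]
        exact step x j hj ih
    calc _ ≤ _ := Set.ncard_le_ncard hsub (Set.toFinite _)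
      _ ≤ _ := Set.ncard_union_le _ _
      _ ≤ 2 ^ J.card + 2 ^ J.card :=
        add_le_add (ih hJ.1) ((Set.ncard_image_le (Set.toFinite _)).trans (ih hJ.1))
      _ = 2 ^ (insert i J).card := by rw [Finset.card_insert_of_notMem hi]; ring

/-! ### Minimum weight -/

open scoped Classical in
theorem filter_mem_standardSubgroup_empty (cs : CoxeterSystem M W) {A : Finset W} {a : W}
    (ha : a ∈ A) : (A.filter fun x => a⁻¹ * x ∈ standardSubgroup cs ∅) = {a} := by
  ext x
  simp only [standardSubgroup, Finset.coe_empty, Set.image_empty, Subgroup.closure_empty,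
    Subgroup.mem_bot, Finset.mem_filter, Finset.mem_singleton, inv_mul_eq_one]
  exact ⟨fun h => h.2.symm, fun h => ⟨h ▸ ha, h.symm⟩⟩

open scoped Classical in
/-- A nonempty subset of a coset of `⟨T⟩` that meets evenly the cosets of all standard subgroups
of rank `k` inside `⟨T⟩` has at least `2 ^ (|T| + 1 - k)` elements. -/
theorem two_pow_le_card_of_even [Finite B] (cs : CoxeterSystem M W) (T : Finset B) :
    ∀ (k : ℕ) (A : Finset W), A.Nonempty →
      (∀ a ∈ A, ∀ b ∈ A, a⁻¹ * b ∈ standardSubgroup cs T) →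
      (∀ K ⊆ T, K.card = k → ∀ w ∈ A,
        Even (A.filter fun x => w⁻¹ * x ∈ standardSubgroup cs K).card) →
      2 ^ (T.card + 1 - k) ≤ A.card := by
  induction T using Finset.induction_on with
  | empty =>
    rintro (_ | k) A ⟨a, ha⟩ hA heven
    · have h := heven ∅ (Finset.Subset.refl _) rfl a ha
      simp [filter_mem_standardSubgroup_empty cs ha] at h
    · simpa using Finset.card_pos.2 ⟨a, ha⟩
  | insert s T hs ih =>
    rintro k A ⟨a, ha⟩ hA heven
    rw [Finset.card_insert_of_notMem hs]
    -- If `A` lies in one coset of `⟨T⟩`, then `⟨K ∪ {s}⟩` and `⟨K⟩` cut out the same part of it, so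
    -- evenness holds with `k - 1`. Otherwise `A` meets two cosets, and each part satisfies the
    -- bound for `T`.
    by_cases hone : ∀ b ∈ A, a⁻¹ * b ∈ standardSubgroup cs T
    · have hA' : ∀ x ∈ A, ∀ y ∈ A, x⁻¹ * y ∈ standardSubgroup cs T := by
        intro x hx y hy
        have := mul_mem (inv_mem (hone x hx)) (hone y hy)
        rwa [mul_inv_rev, inv_inv, mul_assoc, mul_inv_cancel_left] at this
      rcases k with _ | k
      · have h := heven ∅ (Finset.empty_subset _) rfl a ha
        simp [filter_mem_standardSubgroup_empty cs ha] at h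
      · rw [Nat.add_sub_add_right]
        refine ih k A ⟨a, ha⟩ hA' fun K hK hKk w hw => ?_
        have hsK : s ∉ K := fun h => hs (hK h)
        have h := heven (insert s K) (Finset.insert_subset_insert s hK)
          (by rw [Finset.card_insert_of_notMem hsK, hKk]) w hw
        convert h using 2
        refine Finset.filter_congr fun x hx => ⟨fun h => ?_, fun h => ?_⟩
        · exact standardSubgroup_mono cs (Finset.subset_insert s K) h
        · have := mem_standardSubgroup_inter cs h (hA' w hw x hx)
          rwa [Finset.insert_inter_of_notMem hs, Finset.inter_eq_left.2 hK] at this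
    · push Not at hone
      obtain ⟨b, hb, hab⟩ := hone
      have key (c : W) (hc : c ∈ A) : 2 ^ (T.card + 1 - k) ≤
          (A.filter fun x => c⁻¹ * x ∈ standardSubgroup cs T).card := by
        refine ih k _ ⟨c, by simp [hc, one_mem]⟩ (fun x hx y hy => ?_) fun K hK hKk w hw => ?_
        · have := mul_mem (inv_mem (Finset.mem_filter.1 hx).2) (Finset.mem_filter.1 hy).2
          rwa [mul_inv_rev, inv_inv, mul_assoc, mul_inv_cancel_left] at this
        · have hw' := Finset.mem_filter.1 hw
          convert heven K (hK.trans (Finset.subset_insert s T)) hKk w hw'.1 using 2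
          rw [Finset.filter_filter]
          refine Finset.filter_congr fun x hx => ⟨fun h => h.2, fun h => ⟨?_, h⟩⟩
          have := mul_mem hw'.2 (standardSubgroup_mono cs hK h)
          rwa [mul_assoc, mul_inv_cancel_left] at this
      have hdisj : Disjoint (A.filter fun x => a⁻¹ * x ∈ standardSubgroup cs T)
          (A.filter fun x => b⁻¹ * x ∈ standardSubgroup cs T) := by
        refine Finset.disjoint_filter.2 fun x _ h1 h2 => hab ?_
        have := mul_mem h1 (inv_mem h2)
        rwa [mul_inv_rev, inv_inv, mul_assoc, mul_inv_cancel_left] at this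
      have hle := Finset.card_le_card (Finset.union_subset
        (Finset.filter_subset (fun x => a⁻¹ * x ∈ standardSubgroup cs T) A)
        (Finset.filter_subset (fun x => b⁻¹ * x ∈ standardSubgroup cs T) A))
      rw [Finset.card_union_of_disjoint hdisj] at hle
      calc 2 ^ (T.card + 1 + 1 - k) ≤ 2 ^ (T.card + 1 - k + 1) :=
            Nat.pow_le_pow_right two_pos (by omega)
        _ = 2 ^ (T.card + 1 - k) + 2 ^ (T.card + 1 - k) := by ring
        _ ≤ A.card := (add_le_add (key a ha) (key b hb)).trans hle

open scoped Classical in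
/-- Codewords of order `r` sum to zero over the cosets of standard subgroups of rank `r + 1`. -/
theorem sum_eq_zero_of_mem_code [Fintype B] [Fintype W] (cs : CoxeterSystem M W) {r : ℕ}
    {f : W → ZMod 2} (hf : f ∈ code cs r) {K : Finset B} (hK : K.card = r + 1) (w : W) :
    ∑ x with w⁻¹ * x ∈ standardSubgroup cs K, f x = 0 := by
  induction hf using Submodule.span_induction with
  | zero => simp
  | add f g _ _ hf hg => simp [Finset.sum_add_distrib, hf, hg]
  | smul c f _ hf => simp [← Finset.mul_sum, hf]
  | mem f hf =>
    obtain ⟨σ, J, hJ, rfl⟩ := hf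
    -- The ranks add up to `m + 1`. Right multiplication by the shared generator is then a
    -- fixed-point-free involution preserving both cosets.
    obtain ⟨i, hi⟩ : (J ∩ K).Nonempty := by
      rw [← Finset.card_pos]
      have h1 := Finset.card_union_add_card_inter J K
      have h2 := Finset.card_le_univ (J ∪ K)
      omega
    rw [Finset.mem_inter] at hi
    have hmem {L : Finset B} (hL : i ∈ L) (x : W) :
        x * cs.simple i ∈ standardSubgroup cs L ↔ x ∈ standardSubgroup cs L :=
      Subgroup.mul_mem_cancel_right _ (Subgroup.subset_closure ⟨i, hL, rfl⟩)
    refine Finset.sum_involution (fun x _ => x * cs.simple i) (fun x _ => ?_) (fun x _ _ h => ?_)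
      (fun x hx => ?_) (fun x _ => cs.simple_mul_simple_cancel_right i)
    · have : x * cs.simple i ∈ σ • (standardSubgroup cs J : Set W) ↔
          x ∈ σ • (standardSubgroup cs J : Set W) := by
        simp only [Set.mem_smul_set_iff_inv_smul_mem, smul_eq_mul, ← mul_assoc, SetLike.mem_coe,
          hmem hi.1]
      simp only [indicator, Set.indicator_apply, this]
      exact CharTwo.add_self_eq_zero _
    · have h1 := cs.length_simple i
      rw [mul_eq_left.1 h, cs.length_one] at h1
      exact zero_ne_one h1
    · simpa [← mul_assoc, hmem hi.2] using hx

theorem two_pow_le_hammingNorm_of_mem_code [Fintype B] [Fintype W] (cs : CoxeterSystem M W)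
    {r : ℕ} {f : W → ZMod 2} (hf : f ∈ code cs r) (hf0 : f ≠ 0) :
    2 ^ (Fintype.card B - r) ≤ hammingNorm f := by
  classical
  have h := two_pow_le_card_of_even cs Finset.univ (r + 1) (Finset.univ.filter fun x => f x ≠ 0)
    ?_ (fun a _ b _ => ?_) (fun K _ hK w _ => ?_)
  · rwa [Nat.add_sub_add_right, Finset.card_univ] at h
  · obtain ⟨x, hx⟩ := Function.ne_iff.1 hf0
    exact ⟨x, by simpa using hx⟩
  · rw [standardSubgroup, Finset.coe_univ, Set.image_univ, cs.subgroup_closure_range_simple]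
    trivial
  · have hsum := sum_eq_zero_of_mem_code cs hf hK w
    rw [← Finset.sum_filter_ne_zero] at hsum
    rw [← ZMod.natCast_eq_zero_iff_even, Finset.filter_comm, Finset.card_eq_sum_ones,
      Nat.cast_sum]
    refine Eq.trans ?_ hsum
    refine Finset.sum_congr rfl fun x hx => ?_
    have hx' := (Finset.mem_filter.1 hx).2
    rw [Nat.cast_one]
    generalize f x = c at hx'
    revert c
    decide

end CoxeterCode

theorem mainTheorem7 {B W : Type*} [Fintype B] [Group W] [Fintype W]
    {M : CoxeterMatrix B} (cs : CoxeterSystem M W)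
    (m r : ℕ) (hm : Fintype.card B = m) (hr : m / 2 ≤ r) (hrm : r ≤ m) :
    CoxeterCode.minDist (CoxeterCode.code cs r) = 2 ^ (m - r) ∧
      ∃ J : Finset B, J.card = m - r ∧
        (J : Set B).Pairwise (fun i j => Commute (cs.simple i) (cs.simple j)) ∧
        CoxeterCode.indicator (CoxeterCode.standardSubgroup cs J : Set W) ∈
          CoxeterCode.code cs r ∧
        hammingNorm (CoxeterCode.indicator (CoxeterCode.standardSubgroup cs J : Set W)) =
          2 ^ (m - r) := by
  classical
  obtain ⟨I, -, hIcard, hI⟩ := CoxeterCode.exists_commuting_subset cs Finset.univ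
  rw [Finset.card_univ, hm] at hIcard
  -- Here `r ≥ ⌊m/2⌋` enters: `m - r ≤ ⌈m/2⌉ ≤ |I|`.
  obtain ⟨J, hJI, hJcard⟩ := Finset.exists_subset_card_eq (show m - r ≤ I.card by omega)
  have hJ : (J : Set B).Pairwise (fun i j => Commute (cs.simple i) (cs.simple j)) :=
    (hI.mono (by exact_mod_cast hJI)).imp fun _ _ h => CoxeterCode.commute_simple_of_eq_two cs h
  set f := CoxeterCode.indicator (CoxeterCode.standardSubgroup cs J : Set W) with hf
  have hfmem : f ∈ CoxeterCode.code cs r :=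
    Submodule.subset_span ⟨1, J, by omega, by rw [one_smul]⟩
  have hf0 : f ≠ 0 := by
    intro h
    have := congrFun h 1
    simp [hf, CoxeterCode.indicator, one_mem] at this
  have hle : hammingNorm f ≤ 2 ^ (m - r) := by
    rw [← hJcard]
    refine le_trans (le_of_eq ?_) (CoxeterCode.card_standardSubgroup_le cs J hJ)
    rw [hammingNorm, Set.ncard_eq_toFinset_card']
    congr 1
    ext x
    simp [hf, CoxeterCode.indicator, Set.indicator_apply]
  have hlower {g : W → ZMod 2} (hg : g ∈ CoxeterCode.code cs r) (hg0 : g ≠ 0) :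
      2 ^ (m - r) ≤ hammingNorm g :=
    hm ▸ CoxeterCode.two_pow_le_hammingNorm_of_mem_code cs hg hg0
  have hweight : hammingNorm f = 2 ^ (m - r) := le_antisymm hle (hlower hfmem hf0)
  refine ⟨IsLeast.csInf_eq ⟨⟨f, hfmem, 0, zero_mem _, hf0, ?_⟩, ?_⟩, J, hJcard, hJ, hfmem, hweight⟩
  · rw [hammingDist_zero_right, hweight]
  · rintro d ⟨x, hx, y, hy, hxy, rfl⟩
    rw [hammingDist_eq_hammingNorm]
    exact hlower (add_mem (neg_mem hx) hy) fun h => hxy (neg_add_eq_zero.1 h)
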